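/- Let $(\Omega,\mathcal F,\mathbb P)$ be a probability space and let $\{x_t\}_{t\in[0,1]}$ be a real Gaussian process on it with $E[x_t]=0$ for all $t\in[0,1]$, with $x_0=x_1$ almost surely, and with $\operatorname{Cov}(x_s,x_t)=\tilde C(t-s)$ for all $s,t\in[0,1]$, where $\tilde C$ is a real function that is continuous on $[-1,1]$. Then there is a real sequence $(c_k)_{k\ge 0}\in\ell^2$ with $$c_n^2=\int_0^1\tilde C(s)\cos(2n\pi s)\,ds,\qquad n=0,1,2,\ldots,$$ and there are two sequences $(Y_k)_k$, $(Y'_k)_k$ of real functions on $\Omega$ such that $$x_t=c_0Y'_0+\sum_{k=1}^\infty c_k\bigl(Y_k\sqrt2\,\sin(2k\pi t)+Y'_k\sqrt2\,\cos(2k\pi t)\bigr)$$ in mean square, uniformly in $t$; that is, if $S_n(t)$ denotes the sum with the series truncated at $k=n$, then $x_t-S_n(t)\in L^2(\mathbb P)$ for all $n,t$ and $\sup_{t\in[0,1]}E\bigl[(x_t-S_n(t))^2\bigr]\to0$ as $n\to\infty$. Here the variables that enter the expansion, namely the families $(Y_k)_{k\ge1,\,c_k\ne0}$ and $(Y'_k)_{k\ge0,\,c_k\ne0}$,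 are two independent families of independent standard Gaussian random variables on $\Omega$. Moreover, after an extension of the probability space, these can be completed to full sequences: there are a probability space $(\Omega',\mathcal F',\mathbb P')$, a measure-preserving map $\pi:\Omega'\to\Omega$, and two independent sequences $(Z_k)_{k\ge0}$, $(Z'_k)_{k\ge0}$ of independent standard Gaussian random variables on $\Omega'$, with $Z_k=Y_k\circ\pi$ whenever $k\ge1$ and $c_k\ne0$ and $Z'_k=Y'_k\circ\pi$ whenever $c_k\ne0$, such that $$x_t\circ\pi=c_0Z'_0+\sum_{k=1}^\infty c_k\bigl(Z_k\sqrt2\,\sin(2k\pi t)+Z'_k\sqrt2\,\cos(2k\pi t)\bigr)$$ in mean square on $\Omega'$, uniformly in $t\in[0,1]$, in the same sense. -/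

import Mathlib

open MeasureTheory ProbabilityTheory Filter Topology
open scoped unitInterval

universe u

/-- The process `x` on `[0,1]` is (weakly) stationary with continuous covariogram `Ct`, that is
`Cov (x_s, x_t) = Ct (t - s)`. Only the values of `Ct` on `[-1,1]` matter. -/
structure HasCovariogram {Ω : Type*} [MeasurableSpace Ω] (x : I → Ω → ℝ) (Ct : ℝ → ℝ)
    (P : Measure Ω) : Prop where
  continuousOn : ContinuousOn Ct (Set.Icc (-1) 1)
  cov_eq : ∀ s t : I, cov[x s, x t; P] = Ct ((t : ℝ) - (s : ℝ))

/-- The class `H`: real Gaussian processes on `[0,1]` with zero mean, continuous stationary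
covariance and `x_0 = x_1` almost surely. -/
structure MemH {Ω : Type*} [MeasurableSpace Ω] (x : I → Ω → ℝ) (P : Measure Ω) : Prop where
  gaussian : IsGaussianProcess x P
  mean_zero : ∀ t : I, ∫ ω, x t ω ∂P = 0
  stationary : ∃ Ct : ℝ → ℝ, HasCovariogram x Ct P
  periodic : x 0 =ᵐ[P] x 1

/-- `Y` and `Y'` are two independent families, each consisting of independent standard Gaussian
random variables. -/
structure IndepStdGaussianFamilies {Ω ι ι' : Type*} [MeasurableSpace Ω] (Y : ι → Ω → ℝ)
    (Y' : ι' → Ω → ℝ) (P : Measure Ω) : Prop where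
  measurable_left : ∀ i, Measurable (Y i)
  measurable_right : ∀ i, Measurable (Y' i)
  law_left : ∀ i, HasLaw (Y i) (gaussianReal 0 1) P
  law_right : ∀ i, HasLaw (Y' i) (gaussianReal 0 1) P
  indep_left : iIndepFun Y P
  indep_right : iIndepFun Y' P
  indep : IndepFun (fun ω i => Y i ω) (fun ω i => Y' i ω) P

/-- `c_0 Y'_0 + ∑_{k=1}^n c_k (Y_k √2 sin (2kπt) + Y'_k √2 cos (2kπt))`. -/
noncomputable def trigPartialSum {Ω : Type*} (c : ℕ → ℝ) (Y Y' : ℕ → Ω → ℝ) (n : ℕ) (t : I)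
    (ω : Ω) : ℝ :=
  c 0 * Y' 0 ω + ∑ k ∈ Finset.Icc 1 n,
    c k * (Y k ω * √2 * Real.sin (2 * k * Real.pi * t)
      + Y' k ω * √2 * Real.cos (2 * k * Real.pi * t))

/-- `S n t → x t` in mean square as `n → ∞`, uniformly in `t ∈ [0,1]`. -/
structure TendstoMeanSquareUniformly {Ω : Type*} [MeasurableSpace Ω] (S : ℕ → I → Ω → ℝ)
    (x : I → Ω → ℝ) (P : Measure Ω) : Prop where
  memLp : ∀ n t, MemLp (fun ω => x t ω - S n t ω) 2 P
  tendsto : TendstoUniformly (fun n t => ∫ ω, (x t ω - S n t ω) ^ 2 ∂P) (fun _ => 0) atTop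

section TrigonometricSystem

open Real

theorem integral_cos_int_mul (m : ℤ) :
    ∫ t in (0 : ℝ)..1, cos (2 * m * π * t) = if m = 0 then 1 else 0 := by
  split_ifs with h
  · simp [h]
  · have h' : (2 * m * π : ℝ) ≠ 0 := by
      have : (m : ℝ) ≠ 0 := by exact_mod_cast h
      positivity
    rw [intervalIntegral.integral_comp_mul_left (fun x => cos x) h', integral_cos]
    have : sin (2 * m * π) = 0 := by
      rw [show (2 * m * π : ℝ) = ((2 * m : ℤ) : ℝ) * π by push_cast; ring]
      exact sin_int_mul_pi _
    simp [this]

theorem integral_sin_int_mul (m : ℤ) : ∫ t in (0 : ℝ)..1, sin (2 * m * π * t) = 0 := by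
  by_cases h : m = 0
  · simp [h]
  · have h' : (2 * m * π : ℝ) ≠ 0 := by
      have : (m : ℝ) ≠ 0 := by exact_mod_cast h
      positivity
    rw [intervalIntegral.integral_comp_mul_left (fun x => sin x) h', integral_sin]
    have : cos (2 * m * π) = 1 := by
      rw [show (2 * m * π : ℝ) = m * (2 * π) by ring]
      exact cos_int_mul_two_pi _
    simp [this]

/-- The functions `√2 sin (2kπt)` (indexed by `inl k`), `1` (indexed by `inr 0`) and
`√2 cos (2kπt)` (indexed by `inr k`, `k ≥ 1`). -/
noncomputable def trigBasis : ℕ ⊕ ℕ → ℝ → ℝ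
  | .inl k, t => √2 * sin (2 * k * π * t)
  | .inr 0, _ => 1
  | .inr (k + 1), t => √2 * cos (2 * (k + 1 : ℕ) * π * t)

theorem trigBasis_inr_zero (t : ℝ) : trigBasis (.inr 0) t = 1 := rfl

theorem trigBasis_inr_of_ne_zero {k : ℕ} (hk : k ≠ 0) (t : ℝ) :
    trigBasis (.inr k) t = √2 * cos (2 * k * π * t) := by
  obtain ⟨k, rfl⟩ := Nat.exists_eq_succ_of_ne_zero hk
  rfl

theorem exists_trigBasis_inr_eq (k : ℕ) :
    ∃ r, ∀ t, trigBasis (.inr k) t = r * cos (2 * k * π * t) := by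
  rcases eq_or_ne k 0 with rfl | hk
  · exact ⟨1, fun t => by simp [trigBasis]⟩
  · exact ⟨_, trigBasis_inr_of_ne_zero hk⟩

theorem continuous_trigBasis (i : ℕ ⊕ ℕ) : Continuous (trigBasis i) := by
  rcases i with k | k
  · change Continuous fun t : ℝ => √2 * sin (2 * k * π * t)
    fun_prop
  · obtain ⟨r, hr⟩ := exists_trigBasis_inr_eq k
    rw [show trigBasis (.inr k) = fun t => r * cos (2 * k * π * t) from funext hr]
    fun_prop

theorem trigBasis_inl_sq_add_inr_sq {k : ℕ} (hk : k ≠ 0) (t : ℝ) :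
    trigBasis (.inl k) t ^ 2 + trigBasis (.inr k) t ^ 2 = 2 := by
  rw [trigBasis_inr_of_ne_zero hk, trigBasis, mul_pow, mul_pow, sq_sqrt zero_le_two, ← mul_add,
    sin_sq_add_cos_sq, mul_one]

theorem integral_cos_mul_cos (j k : ℕ) :
    ∫ t in (0 : ℝ)..1, cos (2 * j * π * t) * cos (2 * k * π * t) =
      ((if (j : ℤ) - k = 0 then 1 else 0) + (if (j : ℤ) + k = 0 then 1 else 0)) / 2 := by
  rw [← integral_cos_int_mul, ← integral_cos_int_mul, ← intervalIntegral.integral_add,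
    ← intervalIntegral.integral_div]
  · congr 1; ext t
    push_cast
    rw [show (2 * ((j : ℝ) - k) * π * t) = 2 * j * π * t - 2 * k * π * t by ring,
      show (2 * ((j : ℝ) + k) * π * t) = 2 * j * π * t + 2 * k * π * t by ring, cos_sub, cos_add]
    ring
  all_goals exact Continuous.intervalIntegrable (by fun_prop) _ _

theorem integral_sin_mul_sin (j k : ℕ) :
    ∫ t in (0 : ℝ)..1, sin (2 * j * π * t) * sin (2 * k * π * t) =
      ((if (j : ℤ) - k = 0 then 1 else 0) - (if (j : ℤ) + k = 0 then 1 else 0)) / 2 := by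
  rw [← integral_cos_int_mul, ← integral_cos_int_mul, ← intervalIntegral.integral_sub,
    ← intervalIntegral.integral_div]
  · congr 1; ext t
    push_cast
    rw [show (2 * ((j : ℝ) - k) * π * t) = 2 * j * π * t - 2 * k * π * t by ring,
      show (2 * ((j : ℝ) + k) * π * t) = 2 * j * π * t + 2 * k * π * t by ring, cos_sub, cos_add]
    ring
  all_goals exact Continuous.intervalIntegrable (by fun_prop) _ _

theorem integral_sin_mul_cos (j k : ℕ) :
    ∫ t in (0 : ℝ)..1, sin (2 * j * π * t) * cos (2 * k * π * t) = 0 := by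
  have h : (0 : ℝ) = ((∫ t in (0 : ℝ)..1, sin (2 * ((j : ℤ) - k : ℤ) * π * t)) +
      ∫ t in (0 : ℝ)..1, sin (2 * ((j : ℤ) + k : ℤ) * π * t)) / 2 := by
    simp only [integral_sin_int_mul]; norm_num
  refine Eq.trans ?_ h.symm
  rw [← intervalIntegral.integral_add, ← intervalIntegral.integral_div]
  · congr 1; ext t
    push_cast
    rw [show (2 * ((j : ℝ) - k) * π * t) = 2 * j * π * t - 2 * k * π * t by ring,
      show (2 * ((j : ℝ) + k) * π * t) = 2 * j * π * t + 2 * k * π * t by ring, sin_sub, sin_add]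
    ring
  all_goals exact Continuous.intervalIntegrable (by fun_prop) _ _

/-- Orthonormality of the trigonometric system in `L²(0,1)`. -/
theorem integral_trigBasis_mul_trigBasis {i j : ℕ ⊕ ℕ} (hi : i ≠ .inl 0) :
    ∫ t in (0 : ℝ)..1, trigBasis i t * trigBasis j t = if i = j then 1 else 0 := by
  have h2 : √2 * √2 = 2 := mul_self_sqrt zero_le_two
  rcases i with i | i <;> rcases j with j | j
  · have hi0 : i ≠ 0 := fun h => hi (by rw [h])
    have : ∀ t, trigBasis (.inl i) t * trigBasis (.inl j) t =
        2 * (sin (2 * i * π * t) * sin (2 * j * π * t)) := fun t => by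
      simp only [trigBasis]; linear_combination
        (sin (2 * i * π * t) * sin (2 * j * π * t)) * h2
    simp only [this, intervalIntegral.integral_const_mul, integral_sin_mul_sin, Sum.inl.injEq]
    have h3 : (i : ℤ) + j ≠ 0 := by omega
    have h4 : (i : ℤ) - j = 0 ↔ i = j := by omega
    simp only [h3, h4, if_false]
    split_ifs <;> norm_num
  · obtain ⟨r, hr⟩ := exists_trigBasis_inr_eq j
    have : ∀ t, trigBasis (.inl i) t * trigBasis (.inr j) t =
        (√2 * r) * (sin (2 * i * π * t) * cos (2 * j * π * t)) := fun t => by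
      rw [hr]; simp only [trigBasis]; ring
    simp [this, intervalIntegral.integral_const_mul, integral_sin_mul_cos]
  · obtain ⟨r, hr⟩ := exists_trigBasis_inr_eq i
    have : ∀ t, trigBasis (.inr i) t * trigBasis (.inl j) t =
        (√2 * r) * (sin (2 * j * π * t) * cos (2 * i * π * t)) := fun t => by
      rw [hr]; simp only [trigBasis]; ring
    simp [this, intervalIntegral.integral_const_mul, integral_sin_mul_cos]
  · rcases eq_or_ne i 0 with rfl | hi0 <;> rcases eq_or_ne j 0 with rfl | hj0
    · simp [trigBasis]
    · have := integral_cos_int_mul j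
      push_cast at this
      simp [trigBasis_inr_zero, trigBasis_inr_of_ne_zero hj0, this, hj0, hj0.symm]
    · have := integral_cos_int_mul i
      push_cast at this
      simp [trigBasis_inr_zero, trigBasis_inr_of_ne_zero hi0, this, hi0]
    · have : ∀ t, trigBasis (.inr i) t * trigBasis (.inr j) t =
          2 * (cos (2 * i * π * t) * cos (2 * j * π * t)) := fun t => by
        rw [trigBasis_inr_of_ne_zero hi0, trigBasis_inr_of_ne_zero hj0]; linear_combination
          (cos (2 * i * π * t) * cos (2 * j * π * t)) * h2
      simp only [this, intervalIntegral.integral_const_mul, integral_cos_mul_cos, Sum.inr.injEq]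
      have h3 : (i : ℤ) + j ≠ 0 := by omega
      have h4 : (i : ℤ) - j = 0 ↔ i = j := by omega
      simp only [h3, h4, if_false]
      split_ifs <;> norm_num

end TrigonometricSystem

section PeriodicKernel

open Real

variable {C : ℝ → ℝ}

/-- The `n`-th cosine coefficient of `C` on `[0,1]`. -/
noncomputable def cosCoeff (C : ℝ → ℝ) (n : ℕ) : ℝ :=
  ∫ s in (0 : ℝ)..1, C s * cos (2 * n * π * s)

/-- The sine coefficients of a function symmetric about `1/2` vanish. -/
theorem integral_mul_sin_eq_zero (hsymm : ∀ u ∈ Set.Icc (0 : ℝ) 1, C (1 - u) = C u) (n : ℕ) :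
    ∫ s in (0 : ℝ)..1, C s * sin (2 * n * π * s) = 0 := by
  have h := intervalIntegral.integral_comp_sub_left (a := 0) (b := 1)
    (fun s => C s * sin (2 * n * π * s)) 1
  simp only [sub_self, sub_zero] at h
  have h2 : ∫ s in (0 : ℝ)..1, C (1 - s) * sin (2 * n * π * (1 - s)) =
      ∫ s in (0 : ℝ)..1, -(C s * sin (2 * n * π * s)) := by
    refine intervalIntegral.integral_congr fun s hs => ?_
    rw [Set.uIcc_of_le zero_le_one] at hs
    simp only [hsymm s hs]
    rw [show 2 * n * π * (1 - s) = n * (2 * π) - 2 * n * π * s by ring, sin_nat_mul_two_pi_sub]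
    ring
  rw [h2, intervalIntegral.integral_neg] at h
  linarith

/-- Change of variables for integrals against a kernel that is `1`-periodic on `[-1,1]`. -/
theorem integral_mul_comp_sub (hper : ∀ u ∈ Set.Icc (0 : ℝ) 1, C (u - 1) = C u)
    (hC01 : C 0 = C 1)
    {g : ℝ → ℝ} (hg : Function.Periodic g 1) {s : ℝ} (hs : s ∈ Set.Icc (0 : ℝ) 1) :
    ∫ t in (0 : ℝ)..1, g t * C (t - s) = ∫ u in (0 : ℝ)..1, C u * g (u + s) := by
  set D : ℝ → ℝ := fun u => C (Int.fract u) with hD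
  have hDper : Function.Periodic D 1 := fun u => by simp [hD]
  have hDC : ∀ u ∈ Set.Icc (-1 : ℝ) 1, D u = C u := by
    intro u hu
    simp only [hD]
    rcases lt_or_ge u 0 with h | h
    · have : Int.fract u = u + 1 := by
        rw [Int.fract_eq_iff]; exact ⟨by linarith [hu.1], by linarith, -1, by push_cast; ring⟩
      rw [this, ← hper (u + 1) ⟨by linarith [hu.1], by linarith⟩, add_sub_cancel_right]
    · rcases eq_or_lt_of_le hu.2 with h1 | h1
      · rw [h1, Int.fract_one, hC01]
      · rw [Int.fract_eq_self.2 ⟨h, h1⟩]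
  have hper' : Function.Periodic (fun t => g (t + s) * D t) 1 := fun t => by
    simp only [hDper t, show t + 1 + s = t + s + 1 by ring, hg (t + s)]
  calc ∫ t in (0 : ℝ)..1, g t * C (t - s)
      = ∫ t in (0 : ℝ)..1, (fun t => g (t + s) * D t) (t - s) := by
        refine intervalIntegral.integral_congr fun t ht => ?_
        rw [Set.uIcc_of_le zero_le_one] at ht
        simp only [sub_add_cancel]
        rw [hDC _ ⟨by linarith [hs.2, ht.1], by linarith [hs.1, ht.2]⟩]
    _ = ∫ t in (0 - s)..(0 - s + 1), g (t + s) * D t := by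
        rw [intervalIntegral.integral_comp_sub_right (fun t => g (t + s) * D t)]; congr 1; ring
    _ = ∫ t in (0 : ℝ)..(0 + 1), g (t + s) * D t := hper'.intervalIntegral_add_eq _ _
    _ = _ := by
        rw [zero_add]
        refine intervalIntegral.integral_congr fun t ht => ?_
        rw [Set.uIcc_of_le zero_le_one] at ht
        rw [hDC _ ⟨by linarith [ht.1], ht.2⟩, mul_comm]

theorem integral_sin_mul_comp_sub (hc : ContinuousOn C (Set.Icc 0 1))
    (hper : ∀ u ∈ Set.Icc (0 : ℝ) 1, C (u - 1) = C u)
    (hsymm : ∀ u ∈ Set.Icc (0 : ℝ) 1, C (1 - u) = C u) (n : ℕ)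
    {s : ℝ} (hs : s ∈ Set.Icc (0 : ℝ) 1) :
    ∫ t in (0 : ℝ)..1, sin (2 * n * π * t) * C (t - s) = cosCoeff C n * sin (2 * n * π * s) := by
  have hint : ∀ f : ℝ → ℝ, Continuous f →
      IntervalIntegrable (fun t => C t * f t) volume 0 1 := fun f hf =>
    (ContinuousOn.mul (by rwa [Set.uIcc_of_le zero_le_one]) hf.continuousOn).intervalIntegrable
  rw [integral_mul_comp_sub hper (by simpa using (hsymm 0 (by simp)).symm)
    (g := fun t => sin (2 * n * π * t)) (fun t => by
      beta_reduce
      rw [show 2 * n * π * (t + 1) = 2 * n * π * t + n * (2 * π) by ring,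
        sin_add_nat_mul_two_pi]) hs]
  have : ∀ u, C u * sin (2 * n * π * (u + s)) =
      C u * sin (2 * n * π * u) * cos (2 * n * π * s) +
        C u * cos (2 * n * π * u) * sin (2 * n * π * s) := fun u => by
    rw [mul_add, sin_add]; ring
  simp only [this]
  rw [intervalIntegral.integral_add ((hint _ (by fun_prop)).mul_const _)
    ((hint _ (by fun_prop)).mul_const _), intervalIntegral.integral_mul_const,
    intervalIntegral.integral_mul_const, integral_mul_sin_eq_zero hsymm, cosCoeff]
  ring

theorem integral_cos_mul_comp_sub (hc : ContinuousOn C (Set.Icc 0 1))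
    (hper : ∀ u ∈ Set.Icc (0 : ℝ) 1, C (u - 1) = C u)
    (hsymm : ∀ u ∈ Set.Icc (0 : ℝ) 1, C (1 - u) = C u) (n : ℕ)
    {s : ℝ} (hs : s ∈ Set.Icc (0 : ℝ) 1) :
    ∫ t in (0 : ℝ)..1, cos (2 * n * π * t) * C (t - s) = cosCoeff C n * cos (2 * n * π * s) := by
  have hint : ∀ f : ℝ → ℝ, Continuous f →
      IntervalIntegrable (fun t => C t * f t) volume 0 1 := fun f hf =>
    (ContinuousOn.mul (by rwa [Set.uIcc_of_le zero_le_one]) hf.continuousOn).intervalIntegrable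
  rw [integral_mul_comp_sub hper (by simpa using (hsymm 0 (by simp)).symm)
    (g := fun t => cos (2 * n * π * t)) (fun t => by
      beta_reduce
      rw [show 2 * n * π * (t + 1) = 2 * n * π * t + n * (2 * π) by ring,
        cos_add_nat_mul_two_pi]) hs]
  have : ∀ u, C u * cos (2 * n * π * (u + s)) =
      C u * cos (2 * n * π * u) * cos (2 * n * π * s) -
        C u * sin (2 * n * π * u) * sin (2 * n * π * s) := fun u => by
    rw [mul_add, cos_add]; ring
  simp only [this]
  rw [intervalIntegral.integral_sub ((hint _ (by fun_prop)).mul_const _)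
    ((hint _ (by fun_prop)).mul_const _), intervalIntegral.integral_mul_const,
    intervalIntegral.integral_mul_const, integral_mul_sin_eq_zero hsymm, cosCoeff]
  ring

/-- The frequency of `trigBasis i`. -/
def trigFreq : ℕ ⊕ ℕ → ℕ := Sum.elim id id

/-- The trigonometric system diagonalizes convolution with a symmetric periodic kernel. -/
theorem integral_trigBasis_mul_comp_sub (hc : ContinuousOn C (Set.Icc 0 1))
    (hper : ∀ u ∈ Set.Icc (0 : ℝ) 1, C (u - 1) = C u)
    (hsymm : ∀ u ∈ Set.Icc (0 : ℝ) 1, C (1 - u) = C u) (i : ℕ ⊕ ℕ)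
    {s : ℝ} (hs : s ∈ Set.Icc (0 : ℝ) 1) :
    ∫ t in (0 : ℝ)..1, trigBasis i t * C (t - s) = cosCoeff C (trigFreq i) * trigBasis i s := by
  rcases i with k | k
  · simp only [trigBasis, mul_assoc √2, intervalIntegral.integral_const_mul,
      integral_sin_mul_comp_sub hc hper hsymm k hs, trigFreq, Sum.elim_inl, id]
    ring
  · obtain ⟨r, hr⟩ := exists_trigBasis_inr_eq k
    simp only [hr, mul_assoc r, intervalIntegral.integral_const_mul,
      integral_cos_mul_comp_sub hc hper hsymm k hs, trigFreq, Sum.elim_inr, id]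
    ring

/-- If the cosine coefficients are summable, the Fourier series converges to `C` at `0`. -/
theorem hasSum_cosCoeff (hc : ContinuousOn C (Set.Icc 0 1))
    (hsymm : ∀ u ∈ Set.Icc (0 : ℝ) 1, C (1 - u) = C u) (hsum : Summable (cosCoeff C)) :
    HasSum (fun n : ℤ => cosCoeff C n.natAbs) (C 0) := by
  have : Fact ((0 : ℝ) < 1) := ⟨one_pos⟩
  let f : C(AddCircle (1 : ℝ), ℂ) :=
    ⟨AddCircle.liftIco 1 0 (fun u => (C u : ℂ)), AddCircle.liftIco_zero_continuous
      (by simpa using (hsymm 0 (by simp)).symm) (Complex.continuous_ofReal.comp_continuousOn hc)⟩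
  have hint : ∀ f : ℝ → ℝ, Continuous f →
      IntervalIntegrable (fun t => C t * f t) volume 0 1 := fun f hf =>
    (ContinuousOn.mul (by rwa [Set.uIcc_of_le zero_le_one]) hf.continuousOn).intervalIntegrable
  have hintC : ∀ f : ℝ → ℝ, Continuous f →
      IntervalIntegrable (fun t => ((C t * f t : ℝ) : ℂ)) volume 0 1 := fun f hf =>
    ⟨(hint f hf).1.ofReal, (hint f hf).2.ofReal⟩
  have hcoef : ∀ n : ℤ, fourierCoeff f n = (cosCoeff C n.natAbs : ℂ) := by
    intro n
    have hcos : cosCoeff C n.natAbs = ∫ s in (0 : ℝ)..1, C s * cos (2 * n * π * s) := by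
      rw [cosCoeff]
      congr 1; ext s
      rcases Int.natAbs_eq n with h | h
      · rw [h]; simp
      · rw [h]; simp
    have hsin : ∫ s in (0 : ℝ)..1, C s * sin (2 * n * π * s) = 0 := by
      have h0 := integral_mul_sin_eq_zero hsymm n.natAbs
      rcases Int.natAbs_eq n with h | h
      · rw [h]; simpa using h0
      · rw [h]; simpa using h0
    change fourierCoeff (AddCircle.liftIco 1 0 (fun u => (C u : ℂ))) n = _
    rw [fourierCoeff_liftIco_eq, fourierCoeffOn_eq_integral]
    have : ∀ x : ℝ, fourier (-n) (x : AddCircle (0 + 1 - 0 : ℝ)) • (C x : ℂ) =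
        ((C x * cos (2 * n * π * x) : ℝ) : ℂ) -
          ((C x * sin (2 * n * π * x) : ℝ) : ℂ) * Complex.I := by
      intro x
      rw [fourier_coe_apply]
      have e : 2 * (π : ℂ) * Complex.I * ((-n : ℤ) : ℂ) * (x : ℂ) / ((0 + 1 - 0 : ℝ) : ℂ) =
        ((-(2 * n * π * x) : ℝ) : ℂ) * Complex.I := by push_cast; ring
      rw [e, Complex.exp_mul_I, ← Complex.ofReal_cos, ← Complex.ofReal_sin, cos_neg, sin_neg]
      simp only [smul_eq_mul]; push_cast; ring
    simp only [this]
    rw [zero_add, intervalIntegral.integral_sub, intervalIntegral.integral_mul_const,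
      intervalIntegral.integral_ofReal, intervalIntegral.integral_ofReal, hsin, hcos]
    · simp
    · exact hintC _ (by fun_prop)
    · exact (hintC _ (by fun_prop)).mul_const _
  have hsumZ : Summable (fun n : ℤ => cosCoeff C n.natAbs) :=
    Summable.of_nat_of_neg (by simpa using hsum) (by simpa using hsum)
  have h := has_pointwise_sum_fourier_series_of_summable (f := f)
    (by simp only [funext hcoef]; exact_mod_cast hsumZ) ((0 : ℝ) : AddCircle (1 : ℝ))
  have hf0 : f ((0 : ℝ) : AddCircle (1 : ℝ)) = C 0 :=
    AddCircle.liftIco_zero_coe_apply (p := (1 : ℝ)) (f := fun u => (C u : ℂ)) (by simp)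
  rw [hf0] at h
  simp only [hcoef, fourier_coe_apply] at h
  rw [← Complex.hasSum_ofReal]
  simpa using h

theorem tendsto_cosCoeff_partial_sum (hc : ContinuousOn C (Set.Icc 0 1))
    (hsymm : ∀ u ∈ Set.Icc (0 : ℝ) 1, C (1 - u) = C u) (hsum : Summable (cosCoeff C)) :
    Tendsto (fun n => cosCoeff C 0 + ∑ k ∈ Finset.Icc 1 n, 2 * cosCoeff C k) atTop
      (𝓝 (C 0)) := by
  have h := (hasSum_cosCoeff hc hsymm hsum).nat_add_neg
  have h2 : HasSum (fun n : ℕ => 2 * cosCoeff C n) (C 0 + cosCoeff C 0) := by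
    simpa [two_mul] using h
  have h3 := (h2.tendsto_sum_nat.comp (tendsto_add_atTop_nat 1)).sub_const (cosCoeff C 0)
  rw [add_sub_cancel_right] at h3
  refine h3.congr fun n => ?_
  simp only [Function.comp]
  rw [Finset.range_eq_Ico, Finset.sum_eq_sum_Ico_succ_bot (Nat.succ_pos n)]
  have : Finset.Ico (0 + 1) (n + 1) = Finset.Icc 1 n := by ext; simp
  rw [this]; ring

end PeriodicKernel

section GaussianClosure

open Complex

variable {Ω : Type*} [MeasurableSpace Ω] {P : Measure Ω}

theorem inner_toLp_eq_integral {f g : Ω → ℝ} (hf : MemLp f 2 P) (hg : MemLp g 2 P) :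
    inner ℝ (hf.toLp f) (hg.toLp g) = ∫ ω, f ω * g ω ∂P := by
  rw [L2.inner_def]
  refine integral_congr_ae ?_
  filter_upwards [hf.coeFn_toLp, hg.coeFn_toLp] with ω h1 h2
  simp [h1, h2, mul_comm]

theorem coeFn_sum_smul_ae_eq {ι : Type*} (s : Finset ι) (a : ι → ℝ) (v : ι → Lp ℝ 2 P) :
    (∑ i ∈ s, a i • v i : Lp ℝ 2 P) =ᵐ[P] fun ω => ∑ i ∈ s, a i * v i ω := by
  have h : ∀ i ∈ s, ∀ᵐ ω ∂P, (a i • v i : Lp ℝ 2 P) ω = a i * v i ω :=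
    fun i _ => Lp.coeFn_smul (a i) (v i)
  filter_upwards [Lp.coeFn_finsetSum s fun i => a i • v i,
    (ae_ball_iff s.countable_toSet).2 h] with ω e1 e2
  rw [e1, Finset.sum_apply]
  exact Finset.sum_congr rfl e2

/-- Every element of the subspace `M` of `L²` is a centred Gaussian variable. -/
def IsGaussianSubspace (M : Submodule ℝ (Lp ℝ 2 P)) : Prop :=
  ∀ v ∈ M, HasLaw v (gaussianReal 0 (‖v‖₊ ^ 2)) P

theorem IsGaussianSubspace.integral_eq_zero {M : Submodule ℝ (Lp ℝ 2 P)}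
    (hM : IsGaussianSubspace M) {v : Lp ℝ 2 P} (hv : v ∈ M) : ∫ ω, v ω ∂P = 0 := by
  have h := (hM v hv).integral_eq
  simpa using h

/-- Any family in a Gaussian subspace is a Gaussian process. -/
theorem IsGaussianSubspace.isGaussianProcess {M : Submodule ℝ (Lp ℝ 2 P)}
    (hM : IsGaussianSubspace M) {ι : Type*} {v : ι → Lp ℝ 2 P} (hv : ∀ i, v i ∈ M) :
    IsGaussianProcess (fun i => (v i : Ω → ℝ)) P := by
  classical
  refine ⟨fun J => ⟨isGaussian_of_map_eq_gaussianReal fun L => ?_⟩⟩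
  set w : Lp ℝ 2 P := ∑ i : J, L (Pi.single i 1) • v i
  have hw : w ∈ M := M.sum_mem fun i _ => M.smul_mem _ (hv i)
  refine ⟨0, ‖w‖₊ ^ 2, ?_⟩
  have hmeas : Measurable fun ω => J.restrict (fun i => v i ω) :=
    measurable_pi_lambda _ fun i => (Lp.stronglyMeasurable (v i)).measurable
  rw [Measure.map_map (by fun_prop) hmeas, ← (hM w hw).map_eq]
  refine Measure.map_congr ?_
  filter_upwards [coeFn_sum_smul_ae_eq Finset.univ (fun i : J => L (Pi.single i 1))
    fun i => v i] with ω e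
  rw [e, Function.comp_apply, ← L.sum_comp_single]
  refine Finset.sum_congr rfl fun i _ => ?_
  rw [mul_comm, ← smul_eq_mul, ← L.map_smul, ← Pi.single_smul, smul_eq_mul, mul_one]
  rfl

variable [IsProbabilityMeasure P]

theorem integrable_cexp_ofReal_mul_I {f : Ω → ℝ} (hf : AEStronglyMeasurable f P) :
    Integrable (fun ω => cexp (f ω * Complex.I)) P :=
  Integrable.of_bound (Complex.continuous_exp.comp_aestronglyMeasurable
    ((continuous_ofReal.comp_aestronglyMeasurable hf).mul_const Complex.I)) 1
    (ae_of_all _ fun ω => by simp [norm_exp_ofReal_mul_I])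

theorem norm_cexp_mul_I_sub_le (a b : ℝ) :
    ‖cexp (a * Complex.I) - cexp (b * Complex.I)‖ ≤ |a - b| := by
  have h : cexp (a * Complex.I) - cexp (b * Complex.I) =
      cexp (b * Complex.I) * (cexp (Complex.I * ((a - b : ℝ) : ℂ)) - 1) := by
    rw [mul_sub, ← Complex.exp_add, mul_one]; congr 2; push_cast; ring
  rw [h, norm_mul, norm_exp_ofReal_mul_I, one_mul]
  exact Real.norm_exp_I_mul_ofReal_sub_one_le

/-- The characteristic function at `1` depends continuously on `v ∈ L²`. -/
theorem continuous_integral_cexp_mul_I :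
    Continuous fun v : Lp ℝ 2 P => ∫ ω, cexp ((v ω : ℝ) * Complex.I) ∂P := by
  refine LipschitzWith.continuous (K := 1) (LipschitzWith.of_dist_le_mul fun v w => ?_)
  have hv := integrable_cexp_ofReal_mul_I (Lp.aestronglyMeasurable v)
  have hw := integrable_cexp_ofReal_mul_I (Lp.aestronglyMeasurable w)
  have hvw : MemLp (fun ω => v ω - w ω) 2 P := (Lp.memLp v).sub (Lp.memLp w)
  rw [NNReal.coe_one, one_mul, dist_eq_norm, dist_eq_norm, ← integral_sub hv hw]
  calc ‖∫ ω, (cexp ((v ω : ℝ) * Complex.I) - cexp ((w ω : ℝ) * Complex.I)) ∂P‖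
      ≤ ∫ ω, ‖cexp ((v ω : ℝ) * Complex.I) - cexp ((w ω : ℝ) * Complex.I)‖ ∂P :=
        norm_integral_le_integral_norm _
    _ ≤ ∫ ω, ‖v ω - w ω‖ ∂P :=
        integral_mono (hv.sub hw).norm (hvw.integrable one_le_two).norm
          fun ω => norm_cexp_mul_I_sub_le _ _
    _ = (eLpNorm (fun ω => v ω - w ω) 1 P).toReal := by
        rw [integral_norm_eq_lintegral_enorm hvw.1, eLpNorm_one_eq_lintegral_enorm]
    _ ≤ (eLpNorm (fun ω => v ω - w ω) 2 P).toReal :=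
        ENNReal.toReal_mono hvw.2.ne (eLpNorm_le_eLpNorm_of_exponent_le one_le_two hvw.1)
    _ = ‖v - w‖ := by
        rw [Lp.norm_def]
        exact congrArg _ (eLpNorm_congr_ae (Lp.coeFn_sub v w).symm)

theorem hasLaw_gaussianReal_of_charFun {M : Submodule ℝ (Lp ℝ 2 P)}
    (hM : ∀ v ∈ M, ∫ ω, cexp ((v ω : ℝ) * Complex.I) ∂P = cexp (-((‖v‖ ^ 2 / 2 : ℝ) : ℂ))) :
    IsGaussianSubspace M := by
  intro v hv
  refine ⟨(Lp.aestronglyMeasurable v).aemeasurable, ?_⟩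
  have : IsProbabilityMeasure (P.map v) :=
    Measure.isProbabilityMeasure_map (Lp.aestronglyMeasurable v).aemeasurable
  refine Measure.ext_of_charFun (funext fun t => ?_)
  rw [charFun_gaussianReal, charFun_apply_real,
    integral_map (Lp.aestronglyMeasurable v).aemeasurable (by fun_prop)]
  have h := hM (t • v) (M.smul_mem t hv)
  have h2 : ∫ ω, cexp (((t • v : Lp ℝ 2 P) ω : ℝ) * Complex.I) ∂P = ∫ ω, cexp (t * v ω * Complex.I) ∂P := by
    refine integral_congr_ae ((Lp.coeFn_smul t v).mono fun ω hω => ?_)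
    simp only [hω, Pi.smul_apply, smul_eq_mul]; push_cast; rfl
  rw [← h2, h, norm_smul]
  congr 1
  push_cast
  rw [mul_pow, ← ofReal_pow ‖t‖, Real.norm_eq_abs, sq_abs]
  simp; ring

/-- The closure in `L²` of a subspace of centred Gaussian variables consists of centred Gaussian
variables. -/
theorem IsGaussianSubspace.topologicalClosure {M : Submodule ℝ (Lp ℝ 2 P)}
    (hM : IsGaussianSubspace M) : IsGaussianSubspace M.topologicalClosure := by
  refine hasLaw_gaussianReal_of_charFun fun v hv => ?_
  have hclosed : IsClosed {v : Lp ℝ 2 P |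
      ∫ ω, cexp ((v ω : ℝ) * Complex.I) ∂P = cexp (-((‖v‖ ^ 2 / 2 : ℝ) : ℂ))} :=
    isClosed_eq continuous_integral_cexp_mul_I (by fun_prop)
  refine closure_minimal (fun w hw => ?_) hclosed hv
  have h := hM w hw
  have h1 : charFun (P.map w) 1 = charFun (gaussianReal 0 (‖w‖₊ ^ 2)) 1 := by rw [h.map_eq]
  rw [charFun_gaussianReal, charFun_apply_real,
    integral_map (Lp.aestronglyMeasurable w).aemeasurable (by fun_prop)] at h1
  simp only [Set.mem_ofPred_eq]
  simpa [neg_div] using h1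

/-- The linear span in `L²` of a centred Gaussian process consists of centred Gaussian
variables. -/
theorem IsGaussianProcess.isGaussianSubspace_span {T : Type*} {x : T → Ω → ℝ}
    (hx : IsGaussianProcess x P) (hmean : ∀ t, ∫ ω, x t ω ∂P = 0) (h2 : ∀ t, MemLp (x t) 2 P) :
    IsGaussianSubspace (Submodule.span ℝ (Set.range fun t => (h2 t).toLp (x t))) := by
  intro v hv
  obtain ⟨a, rfl⟩ := (Finsupp.mem_span_range_iff_exists_finsupp).1 hv
  set v := a.sum fun i r => r • (h2 i).toLp (x i)
  have hva : v =ᵐ[P] fun ω => ∑ i : a.support, a i * x i ω := by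
    have h3 : ∀ i ∈ a.support, ∀ᵐ ω ∂P, (h2 i).toLp (x i) ω = x i ω :=
      fun i _ => (h2 i).coeFn_toLp
    filter_upwards [coeFn_sum_smul_ae_eq a.support a fun i => (h2 i).toLp (x i),
      (ae_ball_iff a.support.countable_toSet).2 h3] with ω e1 e2
    rw [Finset.sum_coe_sort a.support (fun i => a i * x i ω)]
    refine e1.trans (Finset.sum_congr rfl fun i hi => ?_)
    rw [e2 i hi]
  let L : (a.support → ℝ) →L[ℝ] ℝ := ∑ i : a.support, a i • ContinuousLinearMap.proj i
  have hg : HasGaussianLaw v P := by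
    refine ((hx.hasGaussianLaw a.support).map_fun L).congr (EventuallyEq.trans ?_ hva.symm)
    exact ae_of_all _ fun ω => by simp [L]
  have hmv : ∫ ω, v ω ∂P = 0 := by
    rw [integral_congr_ae hva, integral_finsetSum _ fun (i : a.support) _ =>
      ((h2 i).integrable one_le_two).const_mul (a i)]
    simp [integral_const_mul, hmean]
  refine ⟨hg.aemeasurable, ?_⟩
  rw [hg.map_eq_gaussianReal, hmv]
  congr 1
  rw [variance_eq_integral hg.aemeasurable, hmv]
  have : ‖v‖ ^ 2 = ∫ ω, v ω ^ 2 ∂P := by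
    rw [← real_inner_self_eq_norm_sq, L2.inner_def]
    simp [sq]
  simp only [sub_zero, ← this]
  ext; simp

theorem IsGaussianSubspace.covariance_eq_inner {M : Submodule ℝ (Lp ℝ 2 P)}
    (hM : IsGaussianSubspace M) {v : Lp ℝ 2 P} (hv : v ∈ M) (w : Lp ℝ 2 P) :
    cov[v, w; P] = inner ℝ v w := by
  rw [covariance_eq_sub (Lp.memLp v) (Lp.memLp w), hM.integral_eq_zero hv, L2.inner_def]
  simp [mul_comm]

/-- The members of an orthogonal family in a Gaussian subspace are independent. -/
theorem IsGaussianSubspace.iIndepFun {M : Submodule ℝ (Lp ℝ 2 P)}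
    (hM : IsGaussianSubspace M) {ι : Type*} {v : ι → Lp ℝ 2 P} (hv : ∀ i, v i ∈ M)
    (horth : Pairwise fun i j => inner ℝ (v i) (v j) = 0) :
    iIndepFun (fun i => (v i : Ω → ℝ)) P := by
  have h := IsGaussianProcess.iIndepFun_of_covariance_eq_zero (P := P)
    (S := fun _ : ι => Unit) (X := fun i _ => (v i : Ω → ℝ))
    (hM.isGaussianProcess fun p => hv p.1) (fun i _ => (Lp.aestronglyMeasurable (v i)).aemeasurable)
    fun i j hij _ _ => by rw [hM.covariance_eq_inner (hv i), horth hij]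
  exact h.comp (fun _ f => f ()) fun _ => measurable_pi_apply _

end GaussianClosure

section Independence

variable {Ω ι ι' : Type*} [MeasurableSpace Ω] {P : Measure Ω}

theorem iIndepFun.indepFun_elim {𝓧 : Type*} [MeasurableSpace 𝓧] {Y : ι → Ω → 𝓧} {Y' : ι' → Ω → 𝓧}
    (hY : ∀ i, Measurable (Y i)) (hY' : ∀ i, Measurable (Y' i))
    (h : iIndepFun (Sum.elim Y Y') P) :
    IndepFun (fun ω i => Y i ω) (fun ω i => Y' i ω) P := by
  have := h.isProbabilityMeasure
  refine IndepFun.process_indepFun_process hY hY' fun S T => ?_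
  have h1 := h.indepFun_finset (S.map ⟨Sum.inl, Sum.inl_injective⟩)
    (T.map ⟨Sum.inr, Sum.inr_injective⟩) (by
      rw [Finset.disjoint_left]; intro a ha hb
      simp only [Finset.mem_map, Function.Embedding.coeFn_mk] at ha hb
      obtain ⟨_, _, rfl⟩ := ha
      obtain ⟨_, _, hb⟩ := hb
      cases hb) (by rintro (i | i); exacts [hY i, hY' i])
  exact h1.comp
    (φ := fun f (i : S) => f ⟨Sum.inl i, Finset.mem_map_of_mem ⟨Sum.inl, Sum.inl_injective⟩ i.2⟩)
    (ψ := fun f (i : T) => f ⟨Sum.inr i, Finset.mem_map_of_mem ⟨Sum.inr, Sum.inr_injective⟩ i.2⟩)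
    (by fun_prop) (by fun_prop)

theorem IndepStdGaussianFamilies.of_iIndepFun {Y : ι → Ω → ℝ} {Y' : ι' → Ω → ℝ}
    (hm : ∀ i, Measurable (Sum.elim Y Y' i))
    (hlaw : ∀ i, HasLaw (Sum.elim Y Y' i) (gaussianReal 0 1) P)
    (h : iIndepFun (Sum.elim Y Y') P) : IndepStdGaussianFamilies Y Y' P where
  measurable_left i := hm (.inl i)
  measurable_right i := hm (.inr i)
  law_left i := hlaw (.inl i)
  law_right i := hlaw (.inr i)
  indep_left := h.precomp (g := Sum.inl) Sum.inl_injective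
  indep_right := h.precomp (g := Sum.inr) Sum.inr_injective
  indep := iIndepFun.indepFun_elim (fun i => hm (.inl i)) (fun i => hm (.inr i)) h

/-- Independent families on the two factors of a product space are jointly independent. -/
theorem iIndepFun.prod_elim {Ω' 𝓧 : Type*} [MeasurableSpace Ω'] [MeasurableSpace 𝓧]
    {Q : Measure Ω'} [IsProbabilityMeasure P] [IsProbabilityMeasure Q]
    {Y : ι → Ω → 𝓧} {Y' : ι' → Ω' → 𝓧} (h : iIndepFun Y P) (h' : iIndepFun Y' Q) :
    iIndepFun (Sum.elim (fun i => Y i ∘ Prod.fst) (fun i => Y' i ∘ Prod.snd)) (P.prod Q) := by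
  rw [iIndepFun_iff_measure_inter_preimage_eq_mul] at h h' ⊢
  intro S A hA
  have e : ⋂ i ∈ S, Sum.elim (fun i => Y i ∘ Prod.fst) (fun i => Y' i ∘ Prod.snd) i ⁻¹' A i =
      (⋂ i ∈ S.toLeft, Y i ⁻¹' A (.inl i)) ×ˢ (⋂ i ∈ S.toRight, Y' i ⁻¹' A (.inr i)) := by
    ext ω; simp
  have hl : ∀ B : Set Ω, (P.prod Q) (Prod.fst ⁻¹' B) = P B := fun B => by
    rw [← Set.prod_univ, Measure.prod_prod, measure_univ, mul_one]
  have hr : ∀ B : Set Ω', (P.prod Q) (Prod.snd ⁻¹' B) = Q B := fun B => by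
    rw [← Set.univ_prod, Measure.prod_prod, measure_univ, one_mul]
  rw [e, Measure.prod_prod, h S.toLeft (sets := fun i => A (.inl i)) fun i hi =>
      hA _ (Finset.mem_toLeft.1 hi), h' S.toRight (sets := fun i => A (.inr i)) fun i hi =>
      hA _ (Finset.mem_toRight.1 hi)]
  conv_rhs => rw [← Finset.toLeft_disjSum_toRight (u := S), Finset.prod_disjSum]
  simp [Set.preimage_comp, hl, hr]

end Independence

section PeriodicCurve

variable {H : Type*} [NormedAddCommGroup H] [InnerProductSpace ℝ H]

/-- A closed curve `X` in a Hilbert space whose Gram kernel is `C (t - s)`, with `C` continuous. -/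
structure IsStationaryLoop (X : I → H) (C : ℝ → ℝ) : Prop where
  continuousOn : ContinuousOn C (Set.Icc (-1) 1)
  inner_eq : ∀ s t : I, inner ℝ (X s) (X t) = C ((t : ℝ) - (s : ℝ))
  closed : X 0 = X 1

/-- The `i`-th trigonometric Fourier coefficient of the curve `X`. -/
noncomputable def curveCoeff (X : I → H) (i : ℕ ⊕ ℕ) : H :=
  ∫ t in (0 : ℝ)..1, trigBasis i t • X (Set.projIcc 0 1 zero_le_one t)

/-- The `i`-th trigonometric Fourier coefficient of the curve `X`, normalized; it is `0` when the
corresponding cosine coefficient of `C` is `0`. -/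
noncomputable def normalizedCoeff (X : I → H) (C : ℝ → ℝ) (i : ℕ ⊕ ℕ) : H :=
  (√(cosCoeff C (trigFreq i)))⁻¹ • curveCoeff X i

/-- The indices of the trigonometric functions of frequency at most `n`. -/
def trigIndex (n : ℕ) : Finset (ℕ ⊕ ℕ) := (Finset.Icc 1 n).disjSum (Finset.range (n + 1))

theorem ne_inl_zero_of_mem_trigIndex {n : ℕ} {i : ℕ ⊕ ℕ} (hi : i ∈ trigIndex n) : i ≠ .inl 0 := by
  rintro rfl
  simp [trigIndex] at hi

theorem sum_trigIndex {M : Type*} [AddCommMonoid M] (f : ℕ ⊕ ℕ → M) (n : ℕ) :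
    ∑ i ∈ trigIndex n, f i =
      f (.inr 0) + ∑ k ∈ Finset.Icc 1 n, (f (.inl k) + f (.inr k)) := by
  have : Finset.Ico (0 + 1) (n + 1) = Finset.Icc 1 n := by ext; simp
  rw [trigIndex, Finset.sum_disjSum, Finset.range_eq_Ico,
    Finset.sum_eq_sum_Ico_succ_bot (Nat.succ_pos n), this, Finset.sum_add_distrib]
  abel

namespace IsStationaryLoop

variable {X : I → H} {C : ℝ → ℝ}

theorem kernel_sub_one (h : IsStationaryLoop X C) (u : ℝ) (hu : u ∈ Set.Icc (0 : ℝ) 1) :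
    C (u - 1) = C u := by
  have h1 := h.inner_eq 1 ⟨u, hu⟩
  have h0 := h.inner_eq 0 ⟨u, hu⟩
  rw [h.closed, h1] at h0
  simpa using h0

theorem kernel_one_sub (h : IsStationaryLoop X C) (u : ℝ) (hu : u ∈ Set.Icc (0 : ℝ) 1) :
    C (1 - u) = C u := by
  have h1 := h.inner_eq ⟨u, hu⟩ 1
  have h0 := h.inner_eq 0 ⟨u, hu⟩
  rw [h.closed, real_inner_comm, h1] at h0
  simpa using h0

theorem continuousOn_unit (h : IsStationaryLoop X C) : ContinuousOn C (Set.Icc 0 1) :=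
  h.continuousOn.mono (Set.Icc_subset_Icc (by norm_num) le_rfl)

theorem continuous (h : IsStationaryLoop X C) : Continuous X := by
  have hd : ∀ s t, dist (X t) (X s) = √(2 * (C 0 - C ((t : ℝ) - (s : ℝ)))) := fun s t => by
    rw [dist_eq_norm, ← Real.sqrt_sq (norm_nonneg (X t - X s)), norm_sub_sq_real,
      ← real_inner_self_eq_norm_sq, ← real_inner_self_eq_norm_sq, real_inner_comm (X s), h.inner_eq,
      h.inner_eq, h.inner_eq, sub_self, sub_self]
    congr 1; ring
  rw [continuous_iff_continuousAt]
  intro s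
  rw [ContinuousAt, tendsto_iff_dist_tendsto_zero]
  simp only [hd]
  have hc : Continuous fun t : I => √(2 * (C 0 - C ((t : ℝ) - (s : ℝ)))) := by
    refine Real.continuous_sqrt.comp (continuous_const.mul (continuous_const.sub ?_))
    refine h.continuousOn.comp_continuous (by fun_prop) fun t => ?_
    exact ⟨by linarith [t.2.1, s.2.2], by linarith [t.2.2, s.2.1]⟩
  simpa using hc.tendsto s

theorem intervalIntegrable (h : IsStationaryLoop X C) (i : ℕ ⊕ ℕ) :
    IntervalIntegrable (fun t => trigBasis i t • X (Set.projIcc 0 1 zero_le_one t))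
      volume 0 1 :=
  ((continuous_trigBasis i).smul (h.continuous.comp continuous_projIcc)).intervalIntegrable _ _

theorem curveCoeff_mem_topologicalClosure_span [CompleteSpace H] (h : IsStationaryLoop X C)
    (i : ℕ ⊕ ℕ) :
    curveCoeff X i ∈ (Submodule.span ℝ (Set.range X)).topologicalClosure := by
  have : IsProbabilityMeasure (volume.restrict (Set.Ioc (0 : ℝ) 1)) := ⟨by simp⟩
  rw [curveCoeff, intervalIntegral.integral_of_le zero_le_one]
  refine (Submodule.span ℝ (Set.range X)).topologicalClosure.convex.integral_mem
    (Submodule.isClosed_topologicalClosure _) (ae_of_all _ fun t => ?_) (h.intervalIntegrable i).1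
  exact Submodule.smul_mem _ _ (Submodule.le_topologicalClosure _
    (Submodule.subset_span (Set.mem_range_self _)))

theorem normalizedCoeff_mem_topologicalClosure_span [CompleteSpace H] (h : IsStationaryLoop X C)
    (i : ℕ ⊕ ℕ) :
    normalizedCoeff X C i ∈ (Submodule.span ℝ (Set.range X)).topologicalClosure :=
  Submodule.smul_mem _ _ (h.curveCoeff_mem_topologicalClosure_span i)

theorem inner_curveCoeff_right [CompleteSpace H] (h : IsStationaryLoop X C) (w : H) (i : ℕ ⊕ ℕ) :
    inner ℝ w (curveCoeff X i) =
      ∫ t in (0 : ℝ)..1, trigBasis i t * inner ℝ w (X (Set.projIcc 0 1 zero_le_one t)) := by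
  rw [curveCoeff, ← innerSL_apply_apply ℝ,
    ← ContinuousLinearMap.intervalIntegral_comp_comm _ (h.intervalIntegrable i)]
  simp

theorem inner_curveCoeff [CompleteSpace H] (h : IsStationaryLoop X C) (s : I) (i : ℕ ⊕ ℕ) :
    inner ℝ (X s) (curveCoeff X i) = cosCoeff C (trigFreq i) * trigBasis i s := by
  rw [h.inner_curveCoeff_right, ← integral_trigBasis_mul_comp_sub h.continuousOn_unit
    h.kernel_sub_one h.kernel_one_sub i s.2]
  refine intervalIntegral.integral_congr fun t ht => ?_
  rw [Set.uIcc_of_le zero_le_one] at ht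
  simp only [h.inner_eq, Set.projIcc_of_mem _ ht]

theorem inner_curveCoeff_curveCoeff [CompleteSpace H] (h : IsStationaryLoop X C) {i : ℕ ⊕ ℕ}
    (hi : i ≠ .inl 0) (j : ℕ ⊕ ℕ) :
    inner ℝ (curveCoeff X i) (curveCoeff X j) =
      if i = j then cosCoeff C (trigFreq i) else 0 := by
  rw [real_inner_comm, h.inner_curveCoeff_right]
  have : ∫ t in (0 : ℝ)..1,
      trigBasis i t * inner ℝ (curveCoeff X j) (X (Set.projIcc 0 1 zero_le_one t)) =
      ∫ t in (0 : ℝ)..1, cosCoeff C (trigFreq j) * (trigBasis i t * trigBasis j t) := by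
    refine intervalIntegral.integral_congr fun t ht => ?_
    rw [Set.uIcc_of_le zero_le_one] at ht
    simp only [real_inner_comm (X _) (curveCoeff X j), h.inner_curveCoeff, Set.projIcc_of_mem _ ht]
    ring
  rw [this, intervalIntegral.integral_const_mul, integral_trigBasis_mul_trigBasis hi]
  split_ifs with hij
  · rw [hij, mul_one]
  · rw [mul_zero]

theorem cosCoeff_nonneg [CompleteSpace H] (h : IsStationaryLoop X C) (n : ℕ) :
    0 ≤ cosCoeff C n := by
  have := h.inner_curveCoeff_curveCoeff (i := .inr n) (by simp) (.inr n)
  rw [if_pos rfl] at this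
  exact this ▸ real_inner_self_nonneg

theorem inner_normalizedCoeff [CompleteSpace H] (h : IsStationaryLoop X C) (s : I) (i : ℕ ⊕ ℕ) :
    inner ℝ (X s) (normalizedCoeff X C i) = √(cosCoeff C (trigFreq i)) * trigBasis i s := by
  rw [normalizedCoeff, inner_smul_right, h.inner_curveCoeff, ← mul_assoc]
  congr 1
  rw [inv_mul_eq_div, Real.div_sqrt]

theorem inner_normalizedCoeff_normalizedCoeff [CompleteSpace H] (h : IsStationaryLoop X C)
    {i : ℕ ⊕ ℕ} (hi : i ≠ .inl 0) (j : ℕ ⊕ ℕ) :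
    inner ℝ (normalizedCoeff X C i) (normalizedCoeff X C j) =
      if i = j ∧ √(cosCoeff C (trigFreq i)) ≠ 0 then 1 else 0 := by
  rw [normalizedCoeff, normalizedCoeff, real_inner_smul_left, real_inner_smul_right,
    h.inner_curveCoeff_curveCoeff hi]
  by_cases hij : i = j
  · subst hij
    by_cases h0 : √(cosCoeff C (trigFreq i)) = 0
    · simp [h0]
    · simp only [if_true, h0, ne_eq, not_false_eq_true, and_self]
      rw [inv_mul_eq_div, inv_mul_eq_div, Real.div_sqrt, div_self h0]
  · simp [hij]

/-- The error of the `n`-th partial sum of the expansion does not depend on the parameter. -/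
theorem norm_sub_sum_sq [CompleteSpace H] (h : IsStationaryLoop X C) (n : ℕ) (t : I) :
    ‖X t - ∑ i ∈ trigIndex n, (√(cosCoeff C (trigFreq i)) * trigBasis i t) •
        normalizedCoeff X C i‖ ^ 2 =
      C 0 - (cosCoeff C 0 + ∑ k ∈ Finset.Icc 1 n, 2 * cosCoeff C k) := by
  set a : ℕ ⊕ ℕ → ℝ := fun i => √(cosCoeff C (trigFreq i)) * trigBasis i t with ha
  have h1 : inner ℝ (X t) (∑ i ∈ trigIndex n, a i • normalizedCoeff X C i) =
      ∑ i ∈ trigIndex n, a i ^ 2 := by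
    rw [inner_sum]
    refine Finset.sum_congr rfl fun i _ => ?_
    rw [inner_smul_right, h.inner_normalizedCoeff, sq]
  have h2 : ‖∑ i ∈ trigIndex n, a i • normalizedCoeff X C i‖ ^ 2 =
      ∑ i ∈ trigIndex n, a i ^ 2 := by
    rw [← real_inner_self_eq_norm_sq, sum_inner]
    refine Finset.sum_congr rfl fun i hi => ?_
    rw [inner_sum, Finset.sum_eq_single i]
    · rw [real_inner_smul_left, real_inner_smul_right,
        h.inner_normalizedCoeff_normalizedCoeff (ne_inl_zero_of_mem_trigIndex hi)]
      by_cases h0 : √(cosCoeff C (trigFreq i)) = 0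
      · simp [ha, h0]
      · simp [h0, sq]
    · intro j _ hji
      rw [real_inner_smul_left, real_inner_smul_right,
        h.inner_normalizedCoeff_normalizedCoeff (ne_inl_zero_of_mem_trigIndex hi)]
      simp [hji.symm]
    · exact fun hi' => absurd hi hi'
  have h3 : ∑ i ∈ trigIndex n, a i ^ 2 =
      cosCoeff C 0 + ∑ k ∈ Finset.Icc 1 n, 2 * cosCoeff C k := by
    rw [sum_trigIndex]
    congr 1
    · simp [ha, trigBasis_inr_zero, trigFreq, Real.sq_sqrt (h.cosCoeff_nonneg 0)]
    · refine Finset.sum_congr rfl fun k hk => ?_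
      have hk0 : k ≠ 0 := by have := (Finset.mem_Icc.1 hk).1; omega
      simp only [ha, trigFreq, Sum.elim_inl, Sum.elim_inr, id, mul_pow,
        Real.sq_sqrt (h.cosCoeff_nonneg k)]
      rw [← mul_add, trigBasis_inl_sq_add_inr_sq hk0, mul_comm]
  rw [norm_sub_sq_real, h1, h2, ← real_inner_self_eq_norm_sq, h.inner_eq, sub_self, h3]
  ring

theorem summable_cosCoeff [CompleteSpace H] (h : IsStationaryLoop X C) :
    Summable (cosCoeff C) := by
  refine (summable_nat_add_iff 1).1 (summable_of_sum_range_le (c := C 0)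
    (fun n => h.cosCoeff_nonneg _) fun n => ?_)
  have h1 := h.norm_sub_sum_sq n 0
  have h2 : ∑ k ∈ Finset.Icc 1 n, cosCoeff C k = ∑ k ∈ Finset.range n, cosCoeff C (k + 1) := by
    rw [Finset.range_eq_Ico, Finset.sum_Ico_add' (fun k => cosCoeff C k)]
    rfl
  have h3 := h.cosCoeff_nonneg 0
  have h4 : 0 ≤ ∑ k ∈ Finset.Icc 1 n, cosCoeff C k :=
    Finset.sum_nonneg fun k _ => h.cosCoeff_nonneg k
  rw [← Finset.mul_sum] at h1
  rw [← h2]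
  nlinarith [sq_nonneg ‖X 0 - ∑ i ∈ trigIndex n, (√(cosCoeff C (trigFreq i)) *
    trigBasis i ((0 : I) : ℝ)) • normalizedCoeff X C i‖]

theorem tendsto_norm_sub_sum_sq [CompleteSpace H] (h : IsStationaryLoop X C) :
    Tendsto (fun n => C 0 - (cosCoeff C 0 + ∑ k ∈ Finset.Icc 1 n, 2 * cosCoeff C k)) atTop
      (𝓝 0) := by
  have := (tendsto_cosCoeff_partial_sum h.continuousOn_unit h.kernel_one_sub
    h.summable_cosCoeff).const_sub (C 0)
  rwa [sub_self] at this

end IsStationaryLoop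

end PeriodicCurve

section MeanSquareExpansion

variable {Ω : Type*}

theorem trigPartialSum_eq_sum_trigIndex (c : ℕ → ℝ) (Y : ℕ ⊕ ℕ → Ω → ℝ) (n : ℕ) (t : I) (ω : Ω) :
    trigPartialSum c (fun k => Y (.inl k)) (fun k => Y (.inr k)) n t ω =
      ∑ i ∈ trigIndex n, c (trigFreq i) * trigBasis i t * Y i ω := by
  rw [sum_trigIndex, trigPartialSum]
  congr 1
  · simp [trigFreq, trigBasis_inr_zero]
  · refine Finset.sum_congr rfl fun k hk => ?_
    have hk0 : k ≠ 0 := by have := (Finset.mem_Icc.1 hk).1; omega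
    rw [trigBasis_inr_of_ne_zero hk0]
    simp only [trigFreq, Sum.elim_inl, Sum.elim_inr, id, trigBasis]
    ring

theorem trigPartialSum_congr_comp {Ω' : Type*} {c : ℕ → ℝ} {Y Y' : ℕ → Ω → ℝ}
    {Z Z' : ℕ → Ω' → ℝ} {π : Ω' → Ω} (hZ : ∀ k, 1 ≤ k → c k ≠ 0 → Z k = Y k ∘ π)
    (hZ' : ∀ k, c k ≠ 0 → Z' k = Y' k ∘ π) (n : ℕ) (t : I) :
    trigPartialSum c Z Z' n t = trigPartialSum c Y Y' n t ∘ π := by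
  ext ω
  simp only [trigPartialSum, Function.comp]
  congr 1
  · by_cases h : c 0 = 0
    · simp [h]
    · rw [hZ' 0 h]; rfl
  · refine Finset.sum_congr rfl fun k hk => ?_
    by_cases h : c k = 0
    · simp [h]
    · rw [hZ k (Finset.mem_Icc.1 hk).1 h, hZ' k h]; rfl

variable [MeasurableSpace Ω] {P : Measure Ω}

theorem TendstoMeanSquareUniformly.of_isStationaryLoop {x : I → Ω → ℝ} {C : ℝ → ℝ}
    (h2 : ∀ t, MemLp (x t) 2 P) (h : IsStationaryLoop (fun t => (h2 t).toLp (x t)) C) :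
    TendstoMeanSquareUniformly
      (trigPartialSum (fun n => √(cosCoeff C n))
        (fun k => (normalizedCoeff (fun t => (h2 t).toLp (x t)) C (.inl k) : Lp ℝ 2 P))
        (fun k => (normalizedCoeff (fun t => (h2 t).toLp (x t)) C (.inr k) : Lp ℝ 2 P))) x P := by
  set X : I → Lp ℝ 2 P := fun t => (h2 t).toLp (x t) with hX
  set D : ℕ → I → Lp ℝ 2 P := fun n t => X t - ∑ i ∈ trigIndex n,
    (√(cosCoeff C (trigFreq i)) * trigBasis i t) • normalizedCoeff X C i
  have hD : ∀ n t, (fun ω => x t ω - trigPartialSum (fun n => √(cosCoeff C n))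
      (fun k => (normalizedCoeff X C (.inl k) : Lp ℝ 2 P))
      (fun k => (normalizedCoeff X C (.inr k) : Lp ℝ 2 P)) n t ω) =ᵐ[P] D n t := fun n t => by
    filter_upwards [Lp.coeFn_sub (X t) (∑ i ∈ trigIndex n,
      (√(cosCoeff C (trigFreq i)) * trigBasis i t) • normalizedCoeff X C i), (h2 t).coeFn_toLp,
      coeFn_sum_smul_ae_eq (trigIndex n) (fun i => √(cosCoeff C (trigFreq i)) * trigBasis i t)
        (normalizedCoeff X C)] with ω e1 e2 e3
    rw [e1, Pi.sub_apply, e3, hX, e2]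
    congr 1
    exact trigPartialSum_eq_sum_trigIndex _ (fun i => (normalizedCoeff X C i : Lp ℝ 2 P)) n t ω
  refine ⟨fun n t => (memLp_congr_ae (hD n t)).2 (Lp.memLp _), ?_⟩
  have hI : ∀ n t, ∫ ω, (x t ω - trigPartialSum (fun n => √(cosCoeff C n))
      (fun k => (normalizedCoeff X C (.inl k) : Lp ℝ 2 P))
      (fun k => (normalizedCoeff X C (.inr k) : Lp ℝ 2 P)) n t ω) ^ 2 ∂P =
      C 0 - (cosCoeff C 0 + ∑ k ∈ Finset.Icc 1 n, 2 * cosCoeff C k) := fun n t => by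
    rw [← h.norm_sub_sum_sq n t, ← real_inner_self_eq_norm_sq, L2.inner_def]
    refine integral_congr_ae ((hD n t).mono fun ω hω => ?_)
    simp only at hω
    simp only [hω, sq]
    rfl
  simp only [hI]
  rw [Metric.tendstoUniformly_iff]
  intro ε hε
  filter_upwards [Metric.tendsto_nhds.1 h.tendsto_norm_sub_sum_sq ε hε] with n hn t
  rwa [dist_comm]

theorem TendstoMeanSquareUniformly.comp_measurePreserving {Ω' : Type*} [MeasurableSpace Ω']
    {P' : Measure Ω'} {π : Ω' → Ω} (hπ : MeasurePreserving π P' P) {S : ℕ → I → Ω → ℝ}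
    {x : I → Ω → ℝ} (h : TendstoMeanSquareUniformly S x P) :
    TendstoMeanSquareUniformly (fun n t => S n t ∘ π) (fun t => x t ∘ π) P' where
  memLp n t := (h.memLp n t).comp_measurePreserving hπ
  tendsto := by
    convert h.tendsto using 3 with n t
    rw [← hπ.map_eq, integral_map hπ.measurable.aemeasurable]
    · rfl
    · rw [hπ.map_eq]
      exact (h.memLp n t).1.pow 2

/-- A partially defined pair of families of independent standard Gaussian variables is completed
on an extension of the probability space. -/
theorem exists_extension_indepStdGaussianFamilies {Ω : Type u} [MeasurableSpace Ω] (P : Measure Ω)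
    [IsProbabilityMeasure P] {p p' : ℕ → Prop} {Y Y' : ℕ → Ω → ℝ}
    (hm : ∀ i, Measurable (Sum.elim (fun k : {k // p k} => Y k) (fun k : {k // p' k} => Y' k) i))
    (hlaw : ∀ i, HasLaw (Sum.elim (fun k : {k // p k} => Y k) (fun k : {k // p' k} => Y' k) i)
      (gaussianReal 0 1) P)
    (hind : iIndepFun (Sum.elim (fun k : {k // p k} => Y k) (fun k : {k // p' k} => Y' k)) P) :
    ∃ (Ω' : Type u) (_ : MeasurableSpace Ω') (P' : Measure Ω') (_ : IsProbabilityMeasure P')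
      (π : Ω' → Ω), MeasurePreserving π P' P ∧ ∃ Z Z' : ℕ → Ω' → ℝ,
        (∀ k, p k → Z k = Y k ∘ π) ∧ (∀ k, p' k → Z' k = Y' k ∘ π) ∧
        IndepStdGaussianFamilies Z Z' P' := by
  classical
  let Q : Measure (ℕ ⊕ ℕ → ℝ) := Measure.infinitePi fun _ => gaussianReal 0 1
  let U : {k // p k} ⊕ {k // p' k} → Ω → ℝ :=
    Sum.elim (fun k : {k // p k} => Y k) (fun k : {k // p' k} => Y' k)
  let W : ({k // p k} ⊕ {k // p' k}) ⊕ (ℕ ⊕ ℕ) → Ω × (ℕ ⊕ ℕ → ℝ) → ℝ :=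
    Sum.elim (fun i => U i ∘ Prod.fst) (fun i => (fun ω : ℕ ⊕ ℕ → ℝ => ω i) ∘ Prod.snd)
  have hfst : MeasurePreserving Prod.fst (P.prod Q) P := measurePreserving_fst
  have hsnd : MeasurePreserving Prod.snd (P.prod Q) Q := measurePreserving_snd
  have hWm : ∀ i, Measurable (W i) := by
    rintro (i | i)
    · exact (hm i).comp measurable_fst
    · exact (measurable_pi_apply i).comp measurable_snd
  have hWlaw : ∀ i, HasLaw (W i) (gaussianReal 0 1) (P.prod Q) := by
    rintro (i | i)
    · exact (hlaw i).comp hfst.hasLaw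
    · exact (measurePreserving_eval_infinitePi (fun _ : ℕ ⊕ ℕ => gaussianReal 0 1) i).hasLaw.comp
        hsnd.hasLaw
  have hWind : iIndepFun W (P.prod Q) :=
    iIndepFun.prod_elim hind (iIndepFun_infinitePi (X := fun _ r => r) fun _ => measurable_id)
  let g : ℕ ⊕ ℕ → ({k // p k} ⊕ {k // p' k}) ⊕ (ℕ ⊕ ℕ) := Sum.elim
    (fun k => if h : p k then .inl (.inl ⟨k, h⟩) else .inr (.inl k))
    (fun k => if h : p' k then .inl (.inr ⟨k, h⟩) else .inr (.inr k))
  have hg : Function.Injective g := by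
    rintro (i | i) (j | j) hij <;> simp only [g, Sum.elim_inl, Sum.elim_inr] at hij <;>
      split_ifs at hij <;> simp_all
  have hW : Sum.elim (fun k => W (g (.inl k))) (fun k => W (g (.inr k))) = fun i => W (g i) := by
    ext i; cases i <;> rfl
  refine ⟨Ω × (ℕ ⊕ ℕ → ℝ), inferInstance, P.prod Q, inferInstance, Prod.fst, hfst,
    fun k => W (g (.inl k)), fun k => W (g (.inr k)), fun k hk => ?_, fun k hk => ?_,
    IndepStdGaussianFamilies.of_iIndepFun ?_ ?_ ?_⟩
  · simp [g, hk, W, U]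
  · simp [g, hk, W, U]
  · rw [hW]; exact fun i => hWm _
  · rw [hW]; exact fun i => hWlaw _
  · rw [hW]; exact hWind.precomp hg

end MeanSquareExpansion

theorem MemH.memLp_two {Ω : Type*} [MeasurableSpace Ω] {P : Measure Ω} {x : I → Ω → ℝ}
    (hx : MemH x P) (t : I) : MemLp (x t) 2 P :=
  (hx.gaussian.hasGaussianLaw_eval t).memLp_two

theorem MemH.isStationaryLoop {Ω : Type*} [MeasurableSpace Ω] {P : Measure Ω}
    [IsProbabilityMeasure P] {x : I → Ω → ℝ} (hx : MemH x P) {Ct : ℝ → ℝ}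
    (hCt : HasCovariogram x Ct P) :
    IsStationaryLoop (fun t => (hx.memLp_two t).toLp (x t)) Ct where
  continuousOn := hCt.continuousOn
  inner_eq s t := by
    rw [inner_toLp_eq_integral, ← hCt.cov_eq, covariance_eq_sub (hx.memLp_two s) (hx.memLp_two t),
      hx.mean_zero, zero_mul, sub_zero]
    rfl
  closed := (MemLp.toLp_eq_toLp_iff _ _).2 hx.periodic

theorem theorem2p1 {Ω : Type u} [MeasurableSpace Ω] (P : Measure Ω) [IsProbabilityMeasure P]
    (x : I → Ω → ℝ) (hx : MemH x P) (Ct : ℝ → ℝ) (hCt : HasCovariogram x Ct P) :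
    ∃ c : ℕ → ℝ,
      Memℓp c 2 ∧
      (∀ n : ℕ, c n ^ 2 = ∫ s in (0 : ℝ)..1, Ct s * Real.cos (2 * n * Real.pi * s)) ∧
      ∃ Y Y' : ℕ → Ω → ℝ,
        IndepStdGaussianFamilies (fun k : {k : ℕ // 1 ≤ k ∧ c k ≠ 0} => Y k)
          (fun k : {k : ℕ // c k ≠ 0} => Y' k) P ∧
        TendstoMeanSquareUniformly (trigPartialSum c Y Y') x P ∧
        -- complete sequences, after an extension of the space that leaves those variables fixed
        ∃ (Ω' : Type u) (_ : MeasurableSpace Ω') (P' : Measure Ω') (_ : IsProbabilityMeasure P')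
          (π : Ω' → Ω), MeasurePreserving π P' P ∧
          ∃ Z Z' : ℕ → Ω' → ℝ,
            (∀ k, 1 ≤ k → c k ≠ 0 → Z k = Y k ∘ π) ∧
            (∀ k, c k ≠ 0 → Z' k = Y' k ∘ π) ∧
            IndepStdGaussianFamilies Z Z' P' ∧
            TendstoMeanSquareUniformly (trigPartialSum c Z Z') (fun t => x t ∘ π) P' := by
  have h2 := hx.memLp_two
  set X : I → Lp ℝ 2 P := fun t => (h2 t).toLp (x t)
  have hX : IsStationaryLoop X Ct := hx.isStationaryLoop hCt
  set c : ℕ → ℝ := fun n => √(cosCoeff Ct n) with hc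
  have hcsq : ∀ n, c n ^ 2 = cosCoeff Ct n := fun n => Real.sq_sqrt (hX.cosCoeff_nonneg n)
  set M := (Submodule.span ℝ (Set.range X)).topologicalClosure
  have hM : IsGaussianSubspace M :=
    (IsGaussianProcess.isGaussianSubspace_span hx.gaussian hx.mean_zero h2).topologicalClosure
  set ξ : ℕ ⊕ ℕ → Lp ℝ 2 P := normalizedCoeff X Ct
  have hξM : ∀ i, ξ i ∈ M := hX.normalizedCoeff_mem_topologicalClosure_span
  let q : {k : ℕ // 1 ≤ k ∧ c k ≠ 0} ⊕ {k : ℕ // c k ≠ 0} → ℕ ⊕ ℕ :=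
    Sum.map Subtype.val Subtype.val
  have hq : Function.Injective q :=
    Sum.map_injective.2 ⟨Subtype.val_injective, Subtype.val_injective⟩
  have hq0 : ∀ i, q i ≠ .inl 0 := by
    rintro (⟨k, hk⟩ | k) h
    · have := Sum.inl_injective h
      simp only at this
      omega
    · cases h
  have hqc : ∀ i, c (trigFreq (q i)) ≠ 0 := by
    rintro (⟨k, hk⟩ | ⟨k, hk⟩)
    exacts [hk.2, hk]
  have hfam : Sum.elim (fun k : {k : ℕ // 1 ≤ k ∧ c k ≠ 0} => (ξ (.inl k) : Ω → ℝ))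
      (fun k : {k : ℕ // c k ≠ 0} => (ξ (.inr k) : Ω → ℝ)) = fun i => (ξ (q i) : Ω → ℝ) := by
    ext i; cases i <;> rfl
  have hm : ∀ i, Measurable (ξ i) := fun i => (Lp.stronglyMeasurable (ξ i)).measurable
  have hlaw : ∀ i, HasLaw (ξ (q i)) (gaussianReal 0 1) P := fun i => by
    have h1 : ‖ξ (q i)‖ ^ 2 = 1 := by
      rw [← real_inner_self_eq_norm_sq, hX.inner_normalizedCoeff_normalizedCoeff (hq0 i),
        if_pos ⟨rfl, hqc i⟩]
    have h3 : ‖ξ (q i)‖₊ ^ 2 = 1 := by ext; simpa using h1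
    simpa only [h3] using hM _ (hξM (q i))
  have hind : iIndepFun (fun i => (ξ (q i) : Ω → ℝ)) P := by
    refine hM.iIndepFun (fun i => hξM (q i)) fun i j hij => ?_
    beta_reduce
    rw [hX.inner_normalizedCoeff_normalizedCoeff (hq0 i), if_neg fun h => hij (hq h.1)]
  have hS := TendstoMeanSquareUniformly.of_isStationaryLoop h2 hX
  have hind' := hfam ▸ hind
  have hm' : ∀ i, Measurable (Sum.elim (fun k : {k : ℕ // 1 ≤ k ∧ c k ≠ 0} => (ξ (.inl k) : Ω → ℝ))
      (fun k : {k : ℕ // c k ≠ 0} => (ξ (.inr k) : Ω → ℝ)) i) := by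
    rw [hfam]; exact fun i => hm _
  have hlaw' : ∀ i, HasLaw (Sum.elim
      (fun k : {k : ℕ // 1 ≤ k ∧ c k ≠ 0} => (ξ (.inl k) : Ω → ℝ))
      (fun k : {k : ℕ // c k ≠ 0} => (ξ (.inr k) : Ω → ℝ)) i) (gaussianReal 0 1) P := by
    rw [hfam]; exact hlaw
  obtain ⟨Ω', mΩ', P', hP', π, hπ, Z, Z', hZ, hZ', hZZ'⟩ :=
    exists_extension_indepStdGaussianFamilies P (p := fun k => 1 ≤ k ∧ c k ≠ 0)
      (p' := fun k => c k ≠ 0) (Y := fun k => (ξ (.inl k) : Ω → ℝ))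
      (Y' := fun k => (ξ (.inr k) : Ω → ℝ)) hm' hlaw' hind'
  refine ⟨c, ?_, hcsq, fun k => ξ (.inl k), fun k => ξ (.inr k),
    IndepStdGaussianFamilies.of_iIndepFun hm' hlaw' hind', hS, Ω', mΩ', P', hP', π, hπ, Z, Z',
    fun k h1 h0 => hZ k ⟨h1, h0⟩, hZ', hZZ', ?_⟩
  · refine memℓp_gen ?_
    simpa [hcsq] using hX.summable_cosCoeff
  · have h := hS.comp_measurePreserving hπ
    convert h using 3 with n t
    exact trigPartialSum_congr_comp (fun k h1 h0 => hZ k ⟨h1, h0⟩) hZ' n t
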